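/- **Absorbing chains.** Let $M$ be a real $m\times m$ matrix and $Q$ a real $m\times 2$ matrix such that $M_{ij}\ge 0$ for $i\ne j$, all $Q_{iu}\ge 0$, $M_{ii}=-\sum_{j\ne i}M_{ij}-(Q_{i1}+Q_{i2})$ for all $i$, and from every $i\in\{1,\dots,m\}$ there is a path of positive rates $M_{ij}$ (possibly of length $0$) to some $k$ with $Q_{k1}+Q_{k2}>0$. Let $(X_t)_{t\ge 0}$ be a right-continuous continuous-time Markov chain, with arbitrary initial law, on the transient states $1,\dots,m$ and the two absorbing states "reneged" and "matched", with generator $\begin{pmatrix}M&Q\\0&0\end{pmatrix}$ (the first column of $Q$ holds the rates into "reneged", the second those into "matched"). Then $M$ is invertible, and with the fundamental matrix $N=-M^{-1}$ and any state $i\in\{1,\dots,m\}$ with $\mathbb P[X_0=i]>0$, $$\mathbb P[\text{Matched}\mid X_0=i]=(NQ)_{i2},$$ and, if this probability is positive, the match time (the first time at which the chain is in "matched") has finite conditional expectation $$\mathbb E[\text{Match Time}\mid X_0=i,\ \text{Matched}]=\frac{(N^2Q)_{i2}}{(NQ)_{i2}}.$$ **The rider chains.** Let $U\ge1$ be an integer,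 $\mu,\eta,\tilde\eta_N\ge0$, $p\in[0,1]$, and $(q_0,\dots,q_U)$ a probability vector, and assume that $\eta>0$, or that $\mu>0$, $p>0$ and $q_\ell>0$ for some $\ell\ge1$. Put $\beta=\mu(1-p)+\tilde\eta_N$. Then the following two pairs $(M,Q)$ satisfy all the assumptions above, so that the formulas hold for them. In both, $Q_{i1}=\eta$ for all $i$, rates not listed are zero, and the diagonal of $M$ is given by the conservation identity. * *First Accept* ($m=U+1$, states $R_0,\dots,R_U$ in this order): $R_0\to R_\ell$ at rate $q_\ell$ for $1\le\ell\le U$; $R_\ell\to R_{\ell-1}$ at rate $\ell\beta$ for $\ell\ge1$; $R_\ell\to$ matched at rate $\ell\mu p$. * *Best Accept* ($m=2U$, states $R_0,\dots,R_U,A_U,\dots,A_2$ in this order): $R_0\to R_\ell$ at rate $q_\ell$ for $1\le\ell\le U$; $R_\ell\to R_{\ell-1}$ at rate $\ell\beta$ for $\ell\ge1$; $R_\ell\to A_j$ at rate $\mu p$ for $2\le j\le\ell$; $R_\ell\to$ matched at rate $\mu p$ for $\ell\ge1$; $A_\ell\to A_j$ for $2\le j<\ell$ at rate $\mu p$, increased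 by $(\ell-1)\beta$ if $j=\ell-1$; $A_\ell\to$ matched at rate $\mu p$ for $\ell\ge3$, and $A_2\to$ matched at rate $\mu+\tilde\eta_N$. -/

import Mathlib

open MeasureTheory ProbabilityTheory Filter Topology
open scoped NNReal

noncomputable section

/-! ### Absorbing continuous-time Markov chains -/

/-- The rates of an absorbing continuous-time Markov chain with transient states `Fin m` and the two
absorbing states `0` (reneged) and `1` (matched): `M` holds the rates among transient states, `Q` the
rates into the absorbing states, the diagonal of `M` is fixed by conservation, and from every
transient state an absorbing state can be reached along transitions of positive rate. -/
structure IsAbsorbingRates {m : ℕ} (M : Matrix (Fin m) (Fin m) ℝ) (Q : Matrix (Fin m) (Fin 2) ℝ) :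
    Prop where
  offDiag_nonneg : ∀ i j, i ≠ j → 0 ≤ M i j
  absorb_nonneg : ∀ i u, 0 ≤ Q i u
  conservation : ∀ i, M i i = -(∑ j ∈ Finset.univ.erase i, M i j) - (Q i 0 + Q i 1)
  absorbing : ∀ i, ∃ k, Relation.ReflTransGen (fun a b => 0 < M a b) i k ∧ ∃ u, 0 < Q k u

/-- The generator of the whole chain; absorbing states have zero outgoing rates. -/
def absorbingGenerator {m : ℕ} (M : Matrix (Fin m) (Fin m) ℝ) (Q : Matrix (Fin m) (Fin 2) ℝ) :
    Matrix (Fin m ⊕ Fin 2) (Fin m ⊕ Fin 2) ℝ :=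
  Matrix.fromBlocks M Q 0 0

/-- `X` is a continuous-time Markov chain with finite state space `E` and generator `G` under `P`:
its paths are right-continuous (for the discrete topology on `E`) and its finite-dimensional
distributions are those of a Markov process with transition matrices `exp (t G)`. The initial law
is arbitrary. -/
structure IsCTMC {E Ω : Type*} [Fintype E] [DecidableEq E] [MeasurableSpace Ω]
    (G : Matrix E E ℝ) (P : Measure Ω) (X : ℝ≥0 → Ω → E) : Prop where
  measurable : ∀ t x, MeasurableSet {ω | X t ω = x}
  rightContinuous : ∀ ω t, ∀ᶠ s in 𝓝[>] t, X s ω = X t ω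
  markov : ∀ (n : ℕ) (t : Fin (n + 1) → ℝ≥0) (x : Fin (n + 1) → E), Monotone t →
    P.real {ω | ∀ k, X (t k) ω = x k} =
      P.real {ω | X (t 0) ω = x 0} *
        ∏ k : Fin n, NormedSpace.exp (((t k.succ : ℝ) - (t k.castSucc : ℝ)) • G)
          (x k.castSucc) (x k.succ)

/-- The fundamental matrix `N = -M⁻¹`. -/
def fundamentalMatrix {m : ℕ} (M : Matrix (Fin m) (Fin m) ℝ) : Matrix (Fin m) (Fin m) ℝ := -M⁻¹

/-- The event that the chain is ever absorbed in the state "matched". -/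
def matchedEvent {m : ℕ} {Ω : Type*} (X : ℝ≥0 → Ω → Fin m ⊕ Fin 2) : Set Ω :=
  {ω | ∃ t, X t ω = Sum.inr 1}

/-- The first time at which the chain is in the state "matched" (only used on `matchedEvent X`). -/
def matchTime {m : ℕ} {Ω : Type*} (X : ℝ≥0 → Ω → Fin m ⊕ Fin 2) (ω : Ω) : ℝ :=
  ((sInf {t : ℝ≥0 | X t ω = Sum.inr 1} : ℝ≥0) : ℝ)

/-! ### The rider chains under First Accept and Best Accept -/

/-- Parameters of a rider's lifecycle: at most `U` drivers are notified at a time, each responds at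
rate `μ` and then accepts with probability `p`; riders renege at rate `η`; notified drivers leave at
rate `ηN`; a waiting rider is notified to exactly `ℓ` drivers with probability `q ℓ`, the
notification rate being normalized to one. -/
structure RiderParams (U : ℕ) where
  μ : ℝ
  p : ℝ
  η : ℝ
  ηN : ℝ
  q : ℕ → ℝ
  μ_nonneg : 0 ≤ μ
  p_nonneg : 0 ≤ p
  p_le_one : p ≤ 1
  η_nonneg : 0 ≤ η
  ηN_nonneg : 0 ≤ ηN
  q_nonneg : ∀ ℓ, 0 ≤ q ℓ
  q_sum : ∑ ℓ ∈ Finset.range (U + 1), q ℓ = 1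

/-- A rider can leave the platform at all: riders renege, or else notifications are sent out with
positive probability and drivers accept at a positive rate. -/
def RiderParams.CanLeave {U : ℕ} (c : RiderParams U) : Prop :=
  0 < c.η ∨ (0 < c.μ ∧ 0 < c.p ∧ ∃ ℓ, 1 ≤ ℓ ∧ ℓ ≤ U ∧ 0 < c.q ℓ)

/-- The transient rate matrix with off-diagonal entries `r` and diagonal fixed by conservation. -/
def transientMatrix {m : ℕ} (r : Fin m → Fin m → ℝ) (Q : Matrix (Fin m) (Fin 2) ℝ) :
    Matrix (Fin m) (Fin m) ℝ :=
  Matrix.of fun i j =>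
    if i = j then -(∑ k ∈ Finset.univ.erase i, r i k) - (Q i 0 + Q i 1) else r i j

/-- Transition rate from `R_ℓ` to `R_k`, `k ≠ ℓ`, where `R_ℓ` is the state of a rider with `ℓ`
outstanding notifications. -/
def RiderParams.notifyRate {U : ℕ} (c : RiderParams U) (ℓ k : ℕ) : ℝ :=
  if ℓ = 0 then c.q k
  else if k + 1 = ℓ then (ℓ : ℝ) * (c.μ * (1 - c.p) + c.ηN) else 0

/-- First Accept: the transient states are `R_0, …, R_U`. -/
def RiderParams.faQ {U : ℕ} (c : RiderParams U) : Matrix (Fin (U + 1)) (Fin 2) ℝ :=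
  Matrix.of fun i u => if u = 0 then c.η else ((i : ℕ) : ℝ) * c.μ * c.p

def RiderParams.faM {U : ℕ} (c : RiderParams U) : Matrix (Fin (U + 1)) (Fin (U + 1)) ℝ :=
  transientMatrix (fun i j => c.notifyRate i j) c.faQ

/-- Rider states under Best Accept: `waiting ℓ` is `R_ℓ`, and `accepted ℓ` is `A_ℓ`, in which the
best acceptance so far came from the driver of rank `ℓ`, the `ℓ - 1` better ranked drivers being
still outstanding. -/
inductive RiderState
  | waiting (ℓ : ℕ)
  | accepted (ℓ : ℕ)

/-- The order of the `2U` transient states under Best Accept: `R_0, R_1, …, R_U, A_U, …, A_2`. -/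
def baState (U : ℕ) (i : Fin (2 * U)) : RiderState :=
  if (i : ℕ) ≤ U then RiderState.waiting i else RiderState.accepted (2 * U + 1 - i)

/-- Transition rates between distinct transient states under Best Accept. -/
def RiderParams.baRate {U : ℕ} (c : RiderParams U) : RiderState → RiderState → ℝ
  | .waiting ℓ, .waiting k => c.notifyRate ℓ k
  | .waiting ℓ, .accepted k => if k ≤ ℓ then c.μ * c.p else 0
  | .accepted _, .waiting _ => 0
  | .accepted ℓ, .accepted k =>
      (if k < ℓ then c.μ * c.p else 0) +
        (if k + 1 = ℓ then (k : ℝ) * (c.μ * (1 - c.p) + c.ηN) else 0)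

/-- Rates into "matched" under Best Accept: a rider is matched when the best ranked outstanding
driver accepts, and also when, in `A_2`, the only outstanding driver rejects or leaves. -/
def RiderParams.baMatchRate {U : ℕ} (c : RiderParams U) : RiderState → ℝ
  | .waiting ℓ => if ℓ = 0 then 0 else c.μ * c.p
  | .accepted ℓ => if ℓ = 2 then c.μ + c.ηN else c.μ * c.p

def RiderParams.baQ {U : ℕ} (c : RiderParams U) : Matrix (Fin (2 * U)) (Fin 2) ℝ :=
  Matrix.of fun i u => if u = 0 then c.η else c.baMatchRate (baState U i)

def RiderParams.baM {U : ℕ} (c : RiderParams U) : Matrix (Fin (2 * U)) (Fin (2 * U)) ℝ :=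
  transientMatrix (fun i j => c.baRate (baState U i) (baState U j)) c.baQ

end

section MatrixExponential

open NormedSpace (exp)

variable {n k : Type*} [Fintype n] [DecidableEq n] [Fintype k] [DecidableEq k]

theorem Matrix.hasSum_exp (A : Matrix n n ℝ) :
    HasSum (fun r : ℕ => ((r.factorial : ℝ)⁻¹) • A ^ r) (exp A) := by
  let _ := Matrix.linftyOpNormedRing (n := n) (α := ℝ)
  let _ := Matrix.linftyOpNormedAlgebra (R := ℝ) (n := n) (α := ℝ)
  exact NormedSpace.exp_series_hasSum_exp' (𝕂 := ℝ) A

theorem Matrix.hasDerivAt_exp_smul_apply (A : Matrix n n ℝ) (t : ℝ) (i j : n) :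
    HasDerivAt (fun s : ℝ => exp (s • A) i j) ((exp (t • A) * A) i j) t := by
  let _ := Matrix.linftyOpNormedRing (n := n) (α := ℝ)
  let _ := Matrix.linftyOpNormedAlgebra (R := ℝ) (n := n) (α := ℝ)
  have h := hasDerivAt_exp_smul_const (𝕂 := ℝ) A t
  exact (LinearMap.toContinuousLinearMap
    (Matrix.entryLinearMap ℝ ℝ i j)).hasFDerivAt.comp_hasDerivAt t h

/-- An intertwining relation passes to exponentials. -/
theorem Matrix.exp_mul_of_mul_eq_mul {A : Matrix n n ℝ} {B : Matrix k k ℝ} {S : Matrix n k ℝ}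
    (h : A * S = S * B) : exp A * S = S * exp B := by
  have hpow : ∀ r : ℕ, A ^ r * S = S * B ^ r := by
    intro r
    induction r with
    | zero => simp
    | succ r ih => rw [pow_succ, Matrix.mul_assoc, h, ← Matrix.mul_assoc, ih, pow_succ,
        Matrix.mul_assoc]
  have h1 : HasSum (fun r : ℕ => ((r.factorial : ℝ)⁻¹) • (A ^ r * S)) (exp A * S) := by
    have := (Matrix.hasSum_exp A).map (Matrix.addMonoidHomMulRight S)
      (continuous_id.matrix_mul continuous_const)
    simpa [Function.comp_def, Matrix.addMonoidHomMulRight] using this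
  have h2 : HasSum (fun r : ℕ => ((r.factorial : ℝ)⁻¹) • (A ^ r * S)) (S * exp B) := by
    have := (Matrix.hasSum_exp B).map (Matrix.addMonoidHomMulLeft S)
      (continuous_const.matrix_mul continuous_id)
    simpa [Function.comp_def, Matrix.addMonoidHomMulLeft, hpow] using this
  exact h1.unique h2

theorem Matrix.exp_apply_nonneg {A : Matrix n n ℝ} (h : ∀ i j, 0 ≤ A i j) (i j : n) :
    0 ≤ exp A i j := by
  have hs := (Matrix.hasSum_exp A).map (Matrix.entryLinearMap ℝ ℝ i j)
    (continuous_id.matrix_elem i j)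
  exact hs.nonneg fun r => mul_nonneg (by positivity) (Matrix.pow_apply_nonneg h r i j)

/-- The exponential of a matrix with nonnegative off-diagonal entries is nonnegative. -/
theorem Matrix.exp_apply_nonneg_of_offDiag {A : Matrix n n ℝ} (h : ∀ i j, i ≠ j → 0 ≤ A i j)
    (i j : n) : 0 ≤ exp A i j := by
  set c : ℝ := ∑ l, |A l l| with hc
  have hA : A = (A + c • 1) + (-c) • (1 : Matrix n n ℝ) := by simp
  have hcomm : Commute (A + c • 1) ((-c) • (1 : Matrix n n ℝ)) :=
    (Commute.one_right _).smul_right _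
  have hnn : ∀ a b, 0 ≤ (A + c • (1 : Matrix n n ℝ)) a b := by
    intro a b
    rcases eq_or_ne a b with rfl | hab
    · have : |A a a| ≤ c := Finset.single_le_sum (f := fun l => |A l l|)
        (fun l _ => abs_nonneg _) (Finset.mem_univ a)
      have := neg_abs_le (A a a)
      simp only [Matrix.add_apply, Matrix.smul_apply, Matrix.one_apply_eq, smul_eq_mul, mul_one]
      linarith
    · simpa [Matrix.one_apply_ne hab] using h a b hab
  have hdiag : exp ((-c) • (1 : Matrix n n ℝ)) = Real.exp (-c) • (1 : Matrix n n ℝ) := by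
    have : (-c) • (1 : Matrix n n ℝ) = Matrix.diagonal fun _ => -c := by
      ext a b; simp [Matrix.one_apply, Matrix.diagonal_apply]
    rw [this, Matrix.exp_diagonal]
    ext a b
    simp [Matrix.one_apply, Matrix.diagonal_apply, Pi.coe_exp, Real.exp_eq_exp_ℝ]
  rw [hA, Matrix.exp_add_of_commute _ _ hcomm, hdiag]
  simp only [Matrix.mul_smul, mul_one, Matrix.smul_apply, smul_eq_mul]
  exact mul_nonneg (Real.exp_pos _).le (Matrix.exp_apply_nonneg hnn i j)

end MatrixExponential

namespace IsAbsorbingRates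

open NormedSpace (exp)

variable {m : ℕ} {M : Matrix (Fin m) (Fin m) ℝ} {Q : Matrix (Fin m) (Fin 2) ℝ}

theorem mulVec_apply (h : IsAbsorbingRates M Q) (v : Fin m → ℝ) (i : Fin m) :
    M.mulVec v i =
      ∑ j ∈ Finset.univ.erase i, M i j * (v j - v i) - (Q i 0 + Q i 1) * v i := by
  have h1 : M.mulVec v i = M i i * v i + ∑ j ∈ Finset.univ.erase i, M i j * v j := by
    rw [Matrix.mulVec, dotProduct, Finset.add_sum_erase _ (fun j => M i j * v j)
      (Finset.mem_univ i)]
  simp only [h1, mul_sub, Finset.sum_sub_distrib, ← Finset.sum_mul, h.conservation i]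
  ring

/-- A weak maximum principle. -/
theorem le_zero_of_mulVec_eq_zero (h : IsAbsorbingRates M Q) {v : Fin m → ℝ}
    (hv : M.mulVec v = 0) (i : Fin m) : v i ≤ 0 := by
  by_contra! hi
  have : Nonempty (Fin m) := ⟨i⟩
  obtain ⟨i₀, hmax⟩ := Finite.exists_max v
  have hpos : 0 < v i₀ := hi.trans_le (hmax i)
  have key : ∀ a, v a = v i₀ →
      (∀ j ∈ Finset.univ.erase a, M a j * (v j - v a) = 0) ∧ Q a 0 + Q a 1 = 0 := by
    intro a ha
    have hz : M.mulVec v a = 0 := congrFun hv a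
    rw [h.mulVec_apply] at hz
    have hterm : ∀ j ∈ Finset.univ.erase a, M a j * (v j - v a) ≤ 0 := fun j hj =>
      mul_nonpos_of_nonneg_of_nonpos (h.offDiag_nonneg a j (Finset.ne_of_mem_erase hj).symm)
        (by rw [ha]; linarith [hmax j])
    have hsum := Finset.sum_nonpos hterm
    have hq : 0 ≤ Q a 0 + Q a 1 := add_nonneg (h.absorb_nonneg a 0) (h.absorb_nonneg a 1)
    have hqv : 0 ≤ (Q a 0 + Q a 1) * v a := mul_nonneg hq (by rw [ha]; exact hpos.le)
    refine ⟨(Finset.sum_eq_zero_iff_of_nonpos hterm).1 (by linarith), ?_⟩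
    have : (Q a 0 + Q a 1) * v a = 0 := by linarith
    exact (mul_eq_zero.1 this).resolve_right (by rw [ha]; exact hpos.ne')
  obtain ⟨k, hpath, u, hu⟩ := h.absorbing i₀
  have hk : v k = v i₀ := by
    clear hu
    induction hpath with
    | refl => rfl
    | @tail a b _ hab ih =>
      by_cases hba : b = a
      · rw [hba, ih]
      · have := (key a ih).1 b (by simp [hba])
        have := (mul_eq_zero.1 this).resolve_left hab.ne'
        linarith
  have hq := (key k hk).2
  have h0 := h.absorb_nonneg k 0
  have h1 := h.absorb_nonneg k 1
  fin_cases u <;> simp only [Fin.zero_eta, Fin.mk_one, Fin.isValue] at hu <;> linarith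

theorem isUnit_det (h : IsAbsorbingRates M Q) : IsUnit M.det := by
  rw [← Matrix.isUnit_iff_isUnit_det, ← Matrix.mulVec_injective_iff_isUnit]
  refine (injective_iff_map_eq_zero (M.mulVecLin)).2 fun v hv => ?_
  have hv' : M.mulVec v = 0 := hv
  ext i
  refine le_antisymm (h.le_zero_of_mulVec_eq_zero hv' i) ?_
  have := h.le_zero_of_mulVec_eq_zero (v := -v) (by rw [Matrix.mulVec_neg, hv', neg_zero]) i
  simpa using this

theorem mul_fundamentalMatrix (h : IsAbsorbingRates M Q) : M * fundamentalMatrix M = -1 := by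
  rw [fundamentalMatrix, Matrix.mul_neg, Matrix.mul_nonsing_inv _ h.isUnit_det]

/-- The expected absorption times are nonnegative. -/
theorem nonneg_of_mulVec_eq_neg_one (h : IsAbsorbingRates M Q) {v : Fin m → ℝ}
    (hv : M.mulVec v = -1) (i : Fin m) : 0 ≤ v i := by
  have : Nonempty (Fin m) := ⟨i⟩
  obtain ⟨i₀, hmin⟩ := Finite.exists_min v
  refine le_trans ?_ (hmin i)
  by_contra! hneg
  have hz : M.mulVec v i₀ = -1 := congrFun hv i₀
  rw [h.mulVec_apply] at hz
  have hsum : 0 ≤ ∑ j ∈ Finset.univ.erase i₀, M i₀ j * (v j - v i₀) :=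
    Finset.sum_nonneg fun j hj => mul_nonneg
      (h.offDiag_nonneg i₀ j (Finset.ne_of_mem_erase hj).symm) (by linarith [hmin j])
  have hq : 0 ≤ Q i₀ 0 + Q i₀ 1 := add_nonneg (h.absorb_nonneg _ 0) (h.absorb_nonneg _ 1)
  nlinarith [mul_nonneg hq (neg_nonneg.2 hneg.le)]

theorem mulVec_one (h : IsAbsorbingRates M Q) (i : Fin m) :
    M.mulVec 1 i = -(Q i 0 + Q i 1) := by
  simp [h.mulVec_apply]

theorem exp_smul_apply_nonneg (h : IsAbsorbingRates M Q) {t : ℝ} (ht : 0 ≤ t) (i j : Fin m) :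
    0 ≤ exp (t • M) i j :=
  Matrix.exp_apply_nonneg_of_offDiag
    (fun a b hab => mul_nonneg ht (h.offDiag_nonneg a b hab)) i j

end IsAbsorbingRates

theorem Matrix.hasDerivAt_exp_smul_mulVec {n : Type*} [Fintype n] [DecidableEq n]
    (A : Matrix n n ℝ) (v : n → ℝ) (t : ℝ) (i : n) :
    HasDerivAt (fun s : ℝ => (NormedSpace.exp (s • A)).mulVec v i)
      ((NormedSpace.exp (t • A)).mulVec (A.mulVec v) i) t := by
  rw [Matrix.mulVec_mulVec]
  simp only [Matrix.mulVec, dotProduct]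
  exact HasDerivAt.fun_sum fun j _ => (Matrix.hasDerivAt_exp_smul_apply A t i j).mul_const (v j)

namespace IsAbsorbingRates

open NormedSpace (exp)

variable {m : ℕ} {M : Matrix (Fin m) (Fin m) ℝ} {Q : Matrix (Fin m) (Fin 2) ℝ}

/-- Survival probabilities decay at least like `1 / t`. -/
theorem mul_exp_smul_mulVec_one_le (h : IsAbsorbingRates M Q) {t : ℝ} (ht : 0 ≤ t) (i : Fin m) :
    t * (exp (t • M)).mulVec 1 i ≤ (fundamentalMatrix M).mulVec 1 i := by
  set v := (fundamentalMatrix M).mulVec 1 with hv_def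
  have hv : M.mulVec v = -1 := by
    rw [hv_def, Matrix.mulVec_mulVec, h.mul_fundamentalMatrix, Matrix.neg_mulVec,
      Matrix.one_mulVec]
  have hder : ∀ s : ℝ, HasDerivAt
      (fun s : ℝ => (exp (s • M)).mulVec v i + s * (exp (s • M)).mulVec 1 i)
      (s * (exp (s • M)).mulVec (M.mulVec 1) i) s := by
    intro s
    have h1 := Matrix.hasDerivAt_exp_smul_mulVec M v s i
    have h2 := (hasDerivAt_id s).mul (Matrix.hasDerivAt_exp_smul_mulVec M 1 s i)
    convert! h1.add h2 using 1
    simp [hv, Matrix.mulVec_neg]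
  have hanti : AntitoneOn
      (fun s : ℝ => (exp (s • M)).mulVec v i + s * (exp (s • M)).mulVec 1 i) (Set.Ici 0) := by
    refine antitoneOn_of_deriv_nonpos (convex_Ici 0)
      (fun s _ => (hder s).continuousAt.continuousWithinAt)
      (fun s _ => (hder s).differentiableAt.differentiableWithinAt) fun s hs => ?_
    rw [interior_Ici, Set.mem_Ioi] at hs
    rw [(hder s).deriv]
    rw [Matrix.mulVec, dotProduct]
    refine mul_nonpos_of_nonneg_of_nonpos hs.le (Finset.sum_nonpos fun j _ => ?_)
    refine mul_nonpos_of_nonneg_of_nonpos (h.exp_smul_apply_nonneg hs.le i j) ?_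
    rw [h.mulVec_one]
    linarith [h.absorb_nonneg j 0, h.absorb_nonneg j 1]
  have hle := hanti Set.self_mem_Ici (Set.mem_Ici.2 ht) ht
  have hnn : 0 ≤ (exp (t • M)).mulVec v i := by
    rw [Matrix.mulVec, dotProduct]
    exact Finset.sum_nonneg fun j _ => mul_nonneg (h.exp_smul_apply_nonneg ht i j)
      (h.nonneg_of_mulVec_eq_neg_one hv j)
  simp only [zero_smul, NormedSpace.exp_zero, Matrix.one_mulVec, zero_mul, add_zero] at hle
  linarith

theorem tendsto_exp_smul_apply (h : IsAbsorbingRates M Q) (i j : Fin m) :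
    Tendsto (fun t : ℝ => exp (t • M) i j) atTop (𝓝 0) := by
  have hlim : Tendsto (fun t : ℝ => (fundamentalMatrix M).mulVec 1 i / t) atTop (𝓝 0) :=
    tendsto_const_nhds.div_atTop tendsto_id
  refine tendsto_of_tendsto_of_tendsto_of_le_of_le' tendsto_const_nhds hlim ?_ ?_
  · filter_upwards [eventually_ge_atTop 0] with t ht using h.exp_smul_apply_nonneg ht i j
  · filter_upwards [eventually_gt_atTop 0] with t ht
    rw [le_div_iff₀ ht, mul_comm]
    refine le_trans ?_ (h.mul_exp_smul_mulVec_one_le ht.le i)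
    refine mul_le_mul_of_nonneg_left ?_ ht.le
    simp only [Matrix.mulVec, dotProduct, Pi.one_apply, mul_one]
    exact Finset.single_le_sum (f := fun l => exp (t • M) i l)
      (fun l _ => h.exp_smul_apply_nonneg ht.le i l) (Finset.mem_univ j)

theorem exp_absorbingGenerator_inl_inl (M : Matrix (Fin m) (Fin m) ℝ)
    (Q : Matrix (Fin m) (Fin 2) ℝ) (t : ℝ) (i j : Fin m) :
    exp (t • absorbingGenerator M Q) (Sum.inl i) (Sum.inl j) = exp (t • M) i j := by
  let S : Matrix (Fin m ⊕ Fin 2) (Fin m) ℝ := Matrix.fromRows 1 0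
  have hint : (t • absorbingGenerator M Q) * S = S * (t • M) := by
    rw [Matrix.smul_mul, Matrix.mul_smul]
    simp [S, absorbingGenerator, Matrix.fromRows_mul, Matrix.fromBlocks_mul_fromRows]
  have := congrFun₂ (Matrix.exp_mul_of_mul_eq_mul hint) (Sum.inl i) j
  simp only [S, Matrix.fromRows_mul] at this
  simpa [Matrix.mul_apply, Fintype.sum_sum_type, Matrix.one_apply] using this

theorem exp_absorbingGenerator_inr (M : Matrix (Fin m) (Fin m) ℝ)
    (Q : Matrix (Fin m) (Fin 2) ℝ) (t : ℝ) (u : Fin 2) :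
    exp (t • absorbingGenerator M Q) (Sum.inr u) (Sum.inr u) = 1 := by
  let S : Matrix (Fin 2) (Fin m ⊕ Fin 2) ℝ := Matrix.fromCols 0 1
  have hint : (0 : Matrix (Fin 2) (Fin 2) ℝ) * S = S * (t • absorbingGenerator M Q) := by
    rw [Matrix.mul_smul]
    simp [S, absorbingGenerator, Matrix.fromCols_mul_fromBlocks]
  have := congrFun₂ (Matrix.exp_mul_of_mul_eq_mul hint) u (Sum.inr u)
  simpa [S, NormedSpace.exp_zero, Matrix.mul_apply, Fintype.sum_sum_type, Matrix.one_apply] using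
    this.symm

/-- The probability of having been absorbed in `u` by time `t`. -/
theorem exp_absorbingGenerator_inl_inr (h : IsAbsorbingRates M Q) (t : ℝ) (i : Fin m)
    (u : Fin 2) :
    exp (t • absorbingGenerator M Q) (Sum.inl i) (Sum.inr u) =
      (fundamentalMatrix M * Q) i u - (exp (t • M) * (fundamentalMatrix M * Q)) i u := by
  have hint : (t • absorbingGenerator M Q) *
        Matrix.fromRows (fundamentalMatrix M * Q) (1 : Matrix (Fin 2) (Fin 2) ℝ) =
      Matrix.fromRows (fundamentalMatrix M * Q) (1 : Matrix (Fin 2) (Fin 2) ℝ) *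
        (0 : Matrix (Fin 2) (Fin 2) ℝ) := by
    simp [absorbingGenerator, Matrix.fromBlocks_mul_fromRows, ← Matrix.mul_assoc,
      h.mul_fundamentalMatrix]
  have := congrFun₂ (Matrix.exp_mul_of_mul_eq_mul hint) (Sum.inl i) u
  rw [NormedSpace.exp_zero, Matrix.mul_one, Matrix.fromRows_apply_inl, Matrix.mul_apply,
    Fintype.sum_sum_type] at this
  simp only [exp_absorbingGenerator_inl_inl, Matrix.fromRows_apply_inl, Matrix.fromRows_apply_inr,
    Matrix.one_apply, mul_ite, mul_one, mul_zero, Finset.sum_ite_eq', Finset.mem_univ,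
    if_true, ← Matrix.mul_apply] at this
  linarith

theorem tendsto_exp_smul_mul (h : IsAbsorbingRates M Q) (R : Matrix (Fin m) (Fin 2) ℝ)
    (i : Fin m) (u : Fin 2) :
    Tendsto (fun t : ℝ => (exp (t • M) * R) i u) atTop (𝓝 0) := by
  simp only [Matrix.mul_apply]
  simpa using tendsto_finsetSum Finset.univ
    fun j _ => (h.tendsto_exp_smul_apply i j).mul_const (R j u)

theorem hasDerivAt_exp_smul_mul (h : IsAbsorbingRates M Q) (t : ℝ) (i : Fin m) (u : Fin 2) :
    HasDerivAt (fun s : ℝ => -(exp (s • M) * (fundamentalMatrix M * (fundamentalMatrix M * Q))) i u)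
      ((exp (t • M) * (fundamentalMatrix M * Q)) i u) t := by
  have h1 := (Matrix.hasDerivAt_exp_smul_mulVec M
    (fun j => (fundamentalMatrix M * (fundamentalMatrix M * Q)) j u) t i).neg
  have h2 : M.mulVec (fun j => (fundamentalMatrix M * (fundamentalMatrix M * Q)) j u) =
      fun j => -(fundamentalMatrix M * Q) j u := by
    ext j
    change (M * (fundamentalMatrix M * (fundamentalMatrix M * Q))) j u = _
    rw [← Matrix.mul_assoc, h.mul_fundamentalMatrix]
    simp
  rw [h2] at h1
  refine h1.congr_deriv ?_
  rw [← Pi.neg_def, Matrix.mulVec_neg, Pi.neg_apply, neg_neg]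
  rfl

end IsAbsorbingRates

theorem isAbsorbingRates_transientMatrix {m : ℕ} {r : Fin m → Fin m → ℝ}
    {Q : Matrix (Fin m) (Fin 2) ℝ} (hr : ∀ i j, 0 ≤ r i j) (hQ : ∀ i u, 0 ≤ Q i u)
    (habs : ∀ i, (∃ u, 0 < Q i u) ∨ ∃ k, i ≠ k ∧ 0 < r i k ∧ ∃ u, 0 < Q k u) :
    IsAbsorbingRates (transientMatrix r Q) Q where
  offDiag_nonneg i j hij := by simpa [transientMatrix, hij] using hr i j
  absorb_nonneg := hQ
  conservation i := by
    have : ∑ j ∈ Finset.univ.erase i, transientMatrix r Q i j =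
        ∑ j ∈ Finset.univ.erase i, r i j :=
      Finset.sum_congr rfl fun j hj => by
        simp [transientMatrix, (Finset.ne_of_mem_erase hj).symm]
    rw [this]
    simp [transientMatrix]
  absorbing i := by
    rcases habs i with hi | ⟨k, hik, hrk, hk⟩
    · exact ⟨i, .refl, hi⟩
    · exact ⟨k, .single (by simpa [transientMatrix, hik] using hrk), hk⟩

namespace RiderParams

variable {U : ℕ} (c : RiderParams U)

theorem dropRate_nonneg : 0 ≤ c.μ * (1 - c.p) + c.ηN :=
  add_nonneg (mul_nonneg c.μ_nonneg (sub_nonneg.2 c.p_le_one)) c.ηN_nonneg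

theorem notifyRate_nonneg (ℓ k : ℕ) : 0 ≤ c.notifyRate ℓ k := by
  unfold notifyRate
  split_ifs
  · exact c.q_nonneg k
  · exact mul_nonneg (Nat.cast_nonneg _) c.dropRate_nonneg
  · exact le_rfl

theorem isAbsorbingRates_firstAccept (hc : c.CanLeave) : IsAbsorbingRates c.faM c.faQ := by
  refine isAbsorbingRates_transientMatrix (fun i j => c.notifyRate_nonneg i j)
    (fun i u => ?_) fun i => ?_
  · simp only [faQ, Matrix.of_apply]
    split_ifs
    · exact c.η_nonneg
    · exact mul_nonneg (mul_nonneg (Nat.cast_nonneg _) c.μ_nonneg) c.p_nonneg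
  · rcases hc with hη | ⟨hμ, hp, ℓ, h1, hU, hq⟩
    · exact Or.inl ⟨0, by simpa [faQ] using hη⟩
    · have hpos : ∀ j : Fin (U + 1), (j : ℕ) ≠ 0 → ∃ u, 0 < c.faQ j u := fun j hj => by
        have : (0 : ℝ) < ((j : ℕ) : ℝ) := Nat.cast_pos.2 (Nat.pos_of_ne_zero hj)
        exact ⟨1, by simpa [faQ] using mul_pos (mul_pos this hμ) hp⟩
      by_cases hi : (i : ℕ) = 0
      · refine Or.inr ⟨⟨ℓ, by omega⟩, fun h => ?_, by simpa [notifyRate, hi] using hq,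
          hpos _ (by simp; omega)⟩
        rw [h] at hi
        simp at hi
        omega
      · exact Or.inl (hpos i hi)

theorem baRate_nonneg (s s' : RiderState) : 0 ≤ c.baRate s s' := by
  have hμp := mul_nonneg c.μ_nonneg c.p_nonneg
  cases s <;> cases s' <;> simp only [baRate]
  · exact c.notifyRate_nonneg _ _
  · split_ifs <;> simp [hμp]
  · exact le_rfl
  · refine add_nonneg (by split_ifs <;> simp [hμp]) ?_
    split_ifs
    · exact mul_nonneg (Nat.cast_nonneg _) c.dropRate_nonneg
    · exact le_rfl

theorem baMatchRate_nonneg (s : RiderState) : 0 ≤ c.baMatchRate s := by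
  have hμp := mul_nonneg c.μ_nonneg c.p_nonneg
  cases s <;> simp only [baMatchRate] <;> split_ifs
  exacts [le_rfl, hμp, add_nonneg c.μ_nonneg c.ηN_nonneg, hμp]

theorem isAbsorbingRates_bestAccept (hc : c.CanLeave) : IsAbsorbingRates c.baM c.baQ := by
  refine isAbsorbingRates_transientMatrix (fun i j => c.baRate_nonneg _ _)
    (fun i u => ?_) fun i => ?_
  · simp only [baQ, Matrix.of_apply]
    split_ifs
    · exact c.η_nonneg
    · exact c.baMatchRate_nonneg _
  · rcases hc with hη | ⟨hμ, hp, ℓ, h1, hℓ, hq⟩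
    · exact Or.inl ⟨0, by simpa [baQ] using hη⟩
    · have hμp := mul_pos hμ hp
      have hpos : ∀ j : Fin (2 * U), (j : ℕ) ≠ 0 → ∃ u, 0 < c.baQ j u := fun j hj => by
        refine ⟨1, ?_⟩
        simp only [baQ, Matrix.of_apply, Fin.isValue, one_ne_zero, if_false, baState]
        split_ifs
        · simpa [baMatchRate, hj] using hμp
        · simp only [baMatchRate]
          split_ifs
          · exact add_pos_of_pos_of_nonneg hμ c.ηN_nonneg
          · exact hμp
      by_cases hi : (i : ℕ) = 0
      · refine Or.inr ⟨⟨ℓ, by omega⟩, fun h => ?_,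
          by simpa [baState, baRate, notifyRate, hi, hℓ] using hq, hpos _ (by simp; omega)⟩
        rw [h] at hi
        simp at hi
        omega
      · exact Or.inl (hpos i hi)

end RiderParams

namespace IsCTMC

open NormedSpace (exp)

section Paths

variable {E Ω : Type*} [Fintype E] [DecidableEq E] [MeasurableSpace Ω]
  {G : Matrix E E ℝ} {P : Measure Ω} {X : ℝ≥0 → Ω → E}

theorem exists_mem_eq_of_dense (hX : IsCTMC G P X) {C : Set ℝ≥0} (hC : Dense C) (ω : Ω)
    {t u : ℝ≥0} (htu : t < u) : ∃ q ∈ C, t < q ∧ q < u ∧ X q ω = X t ω := by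
  obtain ⟨v, hv, hsub⟩ := (mem_nhdsGT_iff_exists_Ioo_subset' htu).1 (hX.rightContinuous ω t)
  obtain ⟨q, hq, htq, hqv⟩ := hC.exists_between (lt_min (Set.mem_Ioi.1 hv) htu)
  exact ⟨q, hq, htq, hqv.trans_le (min_le_right _ _),
    hsub ⟨htq, hqv.trans_le (min_le_left _ _)⟩⟩

theorem measurableSet_exists_lt (hX : IsCTMC G P X) (y : E) (c : ℝ≥0) :
    MeasurableSet {ω | ∃ t < c, X t ω = y} := by
  obtain ⟨C, hCc, hC⟩ := TopologicalSpace.exists_countable_dense ℝ≥0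
  have : {ω | ∃ t < c, X t ω = y} = ⋃ q ∈ C ∩ Set.Iio c, {ω | X q ω = y} := by
    ext ω
    simp only [Set.mem_ofPred_eq, Set.mem_iUnion, exists_prop]
    constructor
    · rintro ⟨t, htc, ht⟩
      obtain ⟨q, hq, _, hqc, hqt⟩ := hX.exists_mem_eq_of_dense hC ω htc
      exact ⟨q, ⟨hq, hqc⟩, hqt.trans ht⟩
    · rintro ⟨q, ⟨_, hqc⟩, hq⟩
      exact ⟨q, hqc, hq⟩
  rw [this]
  exact MeasurableSet.biUnion (hCc.mono Set.inter_subset_left) fun q _ => hX.measurable q y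

theorem measurableSet_exists (hX : IsCTMC G P X) (y : E) : MeasurableSet {ω | ∃ t, X t ω = y} := by
  have : {ω | ∃ t, X t ω = y} = ⋃ n : ℕ, {ω | ∃ t < (n : ℝ≥0), X t ω = y} := by
    ext ω
    simp only [Set.mem_ofPred_eq, Set.mem_iUnion]
    constructor
    · rintro ⟨t, ht⟩
      obtain ⟨n, hn⟩ := exists_nat_gt t
      exact ⟨n, t, hn, ht⟩
    · rintro ⟨_, t, _, ht⟩
      exact ⟨t, ht⟩
  rw [this]
  exact MeasurableSet.iUnion fun n => hX.measurableSet_exists_lt y n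

theorem measurable_sInf (hX : IsCTMC G P X) (y : E) :
    Measurable fun ω => sInf {t : ℝ≥0 | X t ω = y} := by
  refine measurable_of_Iio fun c => ?_
  have : (fun ω => sInf {t : ℝ≥0 | X t ω = y}) ⁻¹' Set.Iio c =
      {ω | ∃ t < c, X t ω = y} ∪ ({ω | ∃ t, X t ω = y}ᶜ ∩ {_ω | 0 < c}) := by
    ext ω
    simp only [Set.mem_preimage, Set.mem_Iio, Set.mem_union, Set.mem_inter_iff, Set.mem_compl_iff,
      Set.mem_ofPred_eq]
    rcases Set.eq_empty_or_nonempty {t : ℝ≥0 | X t ω = y} with he | hne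
    · have h0 : ∀ t, X t ω ≠ y := fun t ht => (Set.eq_empty_iff_forall_notMem.1 he t) ht
      simp [h0]
    · have hex : ∃ t, X t ω = y := hne
      rw [csInf_lt_iff (OrderBot.bddBelow _) hne]
      simp only [hex, not_true, false_and, or_false, Set.mem_ofPred_eq]
      exact exists_congr fun t => and_comm
  rw [this]
  exact (hX.measurableSet_exists_lt y c).union
    ((hX.measurableSet_exists y).compl.inter (MeasurableSet.const _))

/-- The infimum of the times spent in a state that is visited belongs to that set of times. -/
theorem apply_sInf_eq (hX : IsCTMC G P X) {y : E} {ω : Ω} (h : ∃ t, X t ω = y) :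
    X (sInf {t : ℝ≥0 | X t ω = y}) ω = y := by
  set S := {t : ℝ≥0 | X t ω = y} with hS
  have hne : S.Nonempty := h
  by_contra hnot
  obtain ⟨v, hv, hsub⟩ := mem_nhdsGT_iff_exists_Ioo_subset.1 (hX.rightContinuous ω (sInf S))
  obtain ⟨t, htS, htv⟩ := (csInf_lt_iff (OrderBot.bddBelow _) hne).1 (Set.mem_Ioi.1 hv)
  have hle : sInf S ≤ t := csInf_le (OrderBot.bddBelow _) htS
  rcases hle.eq_or_lt with heq | hlt
  · exact hnot (heq ▸ htS)
  · exact hnot ((hsub ⟨hlt, htv⟩).symm.trans htS)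

theorem measureReal_inter (hX : IsCTMC G P X) {s t : ℝ≥0} (hst : s ≤ t) (x y : E) :
    P.real ({ω | X s ω = x} ∩ {ω | X t ω = y}) =
      P.real {ω | X s ω = x} * exp (((t : ℝ) - s) • G) x y := by
  have := hX.markov 1 ![s, t] ![x, y] (by
    intro a b hab
    fin_cases a <;> fin_cases b <;> simp_all)
  simpa [Fin.forall_fin_two, Set.ofPred_and] using this

variable [IsFiniteMeasure P]

/-- Almost surely, a state that is preserved by the transition matrices is never left. -/
theorem ae_eq_of_le (hX : IsCTMC G P X) {y : E} (hy : ∀ t : ℝ, exp (t • G) y y = 1) :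
    ∀ᵐ ω ∂P, ∀ s t : ℝ≥0, s ≤ t → X s ω = y → X t ω = y := by
  obtain ⟨C, hCc, hC⟩ := TopologicalSpace.exists_countable_dense ℝ≥0
  have hpair : ∀ s t : ℝ≥0, s ≤ t → ∀ᵐ ω ∂P, X s ω = y → X t ω = y := by
    intro s t hst
    have h1 := hX.measureReal_inter hst y y
    rw [hy, mul_one] at h1
    have h2 := measureReal_inter_add_sdiff (μ := P) (s := {ω | X s ω = y}) (hX.measurable t y)
    have h3 : P.real ({ω | X s ω = y} \ {ω | X t ω = y}) = 0 := by linarith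
    rw [measureReal_eq_zero_iff] at h3
    rw [ae_iff]
    convert! h3 using 2
    ext ω
    simp
  have hall : ∀ᵐ ω ∂P, ∀ s ∈ C, ∀ t ∈ C, s ≤ t → X s ω = y → X t ω = y := by
    rw [ae_ball_iff hCc]
    intro s _
    rw [ae_ball_iff hCc]
    intro t _
    by_cases hst : s ≤ t
    · filter_upwards [hpair s t hst] with ω hω _ using hω
    · exact Eventually.of_forall fun ω h => absurd h hst
  filter_upwards [hall] with ω hω s t hst hs
  rcases hst.eq_or_lt with rfl | hlt
  · exact hs
  · obtain ⟨q, hq, _, hqt, hqs⟩ := hX.exists_mem_eq_of_dense hC ω hlt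
    obtain ⟨r, hr, htr, _, hrt⟩ := hX.exists_mem_eq_of_dense hC ω (lt_add_one t)
    rw [← hrt]
    exact hω q hq r hr (hqt.trans htr).le (hqs.trans hs)

end Paths

section Absorbing

variable {m : ℕ} {M : Matrix (Fin m) (Fin m) ℝ} {Q : Matrix (Fin m) (Fin 2) ℝ}
  {Ω : Type*} [MeasurableSpace Ω] {P : Measure Ω} {X : ℝ≥0 → Ω → Fin m ⊕ Fin 2}

theorem measurableSet_matchedEvent (hX : IsCTMC (absorbingGenerator M Q) P X) :
    MeasurableSet (matchedEvent X) :=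
  hX.measurableSet_exists (Sum.inr 1)

theorem measurable_matchTime (hX : IsCTMC (absorbingGenerator M Q) P X) :
    Measurable (matchTime X) :=
  (hX.measurable_sInf (Sum.inr 1)).coe_nnreal_real

variable [IsFiniteMeasure P]

theorem ae_eq_matched_iff (hX : IsCTMC (absorbingGenerator M Q) P X) :
    ∀ᵐ ω ∂P, ∀ t : ℝ≥0, X t ω = Sum.inr 1 ↔ ω ∈ matchedEvent X ∧ matchTime X ω ≤ t := by
  filter_upwards [hX.ae_eq_of_le
    (IsAbsorbingRates.exp_absorbingGenerator_inr M Q · 1)] with ω hω t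
  refine ⟨fun h => ⟨⟨t, h⟩, NNReal.coe_le_coe.2 (csInf_le (OrderBot.bddBelow _) h)⟩, ?_⟩
  rintro ⟨hm, hle⟩
  exact hω _ t (NNReal.coe_le_coe.1 hle) (hX.apply_sInf_eq hm)

/-- The joint law of the initial state and the match time. -/
theorem measureReal_matchTime_le (h : IsAbsorbingRates M Q)
    (hX : IsCTMC (absorbingGenerator M Q) P X) (i : Fin m) {t : ℝ} (ht : 0 ≤ t) :
    P.real ({ω | X 0 ω = Sum.inl i} ∩ matchedEvent X ∩ {ω | matchTime X ω ≤ t}) =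
      P.real {ω | X 0 ω = Sum.inl i} *
        ((fundamentalMatrix M * Q) i 1 - (exp (t • M) * (fundamentalMatrix M * Q)) i 1) := by
  lift t to ℝ≥0 using ht
  have hmarkov := hX.measureReal_inter (zero_le (a := t)) (Sum.inl i) (Sum.inr 1)
  rw [NNReal.coe_zero, sub_zero, h.exp_absorbingGenerator_inl_inr] at hmarkov
  rw [← hmarkov]
  refine measureReal_congr ?_
  filter_upwards [hX.ae_eq_matched_iff] with ω hω
  refine propext ?_
  change ((X 0 ω = Sum.inl i ∧ ω ∈ matchedEvent X) ∧ matchTime X ω ≤ t) ↔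
    (X 0 ω = Sum.inl i ∧ X t ω = Sum.inr 1)
  rw [hω t, and_assoc]

theorem measureReal_inter_matchedEvent (h : IsAbsorbingRates M Q)
    (hX : IsCTMC (absorbingGenerator M Q) P X) (i : Fin m) :
    P.real ({ω | X 0 ω = Sum.inl i} ∩ matchedEvent X) =
      P.real {ω | X 0 ω = Sum.inl i} * (fundamentalMatrix M * Q) i 1 := by
  set B := {ω | X 0 ω = Sum.inl i} ∩ matchedEvent X with hB
  have hmono : Monotone fun n : ℕ => B ∩ {ω | matchTime X ω ≤ (n : ℝ)} := fun a b hab =>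
    Set.inter_subset_inter_right _ fun ω hω =>
      le_trans (Set.mem_ofPred_eq ▸ hω) (Nat.cast_le.2 hab)
  have hunion : ⋃ n : ℕ, B ∩ {ω | matchTime X ω ≤ (n : ℝ)} = B := by
    rw [← Set.inter_iUnion, Set.inter_eq_left]
    exact fun ω _ => Set.mem_iUnion.2 (exists_nat_ge (matchTime X ω))
  have h1 : Tendsto (fun n : ℕ => P.real (B ∩ {ω | matchTime X ω ≤ (n : ℝ)})) atTop
      (𝓝 (P.real B)) := by
    have := tendsto_measure_iUnion_atTop (μ := P) hmono
    rw [hunion] at this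
    exact (ENNReal.tendsto_toReal (measure_ne_top P B)).comp this
  have h2 : Tendsto (fun n : ℕ => P.real (B ∩ {ω | matchTime X ω ≤ (n : ℝ)})) atTop
      (𝓝 (P.real {ω | X 0 ω = Sum.inl i} * ((fundamentalMatrix M * Q) i 1 - 0))) := by
    simp only [hB, hX.measureReal_matchTime_le h i (Nat.cast_nonneg _)]
    exact (tendsto_const_nhds.sub ((h.tendsto_exp_smul_mul _ i 1).comp
      tendsto_natCast_atTop_atTop)).const_mul _
  rw [sub_zero] at h2
  exact tendsto_nhds_unique h1 h2

theorem measureReal_lt_matchTime (h : IsAbsorbingRates M Q)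
    (hX : IsCTMC (absorbingGenerator M Q) P X) (i : Fin m) {t : ℝ} (ht : 0 ≤ t) :
    P.real ({ω | X 0 ω = Sum.inl i} ∩ matchedEvent X ∩ {ω | t < matchTime X ω}) =
      P.real {ω | X 0 ω = Sum.inl i} * (exp (t • M) * (fundamentalMatrix M * Q)) i 1 := by
  have h1 := hX.measureReal_matchTime_le h i ht
  have h2 := hX.measureReal_inter_matchedEvent h i
  have h3 := measureReal_inter_add_sdiff (μ := P)
    (s := {ω | X 0 ω = Sum.inl i} ∩ matchedEvent X)
    (measurableSet_le hX.measurable_matchTime (measurable_const (a := t)))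
  have h4 : ({ω | X 0 ω = Sum.inl i} ∩ matchedEvent X) \ {ω | matchTime X ω ≤ t} =
      {ω | X 0 ω = Sum.inl i} ∩ matchedEvent X ∩ {ω | t < matchTime X ω} := by
    ext ω
    simp
  rw [h4] at h3
  linarith

theorem cond_measureReal_matchedEvent (h : IsAbsorbingRates M Q)
    (hX : IsCTMC (absorbingGenerator M Q) P X) {i : Fin m}
    (hi : P {ω | X 0 ω = Sum.inl i} ≠ 0) :
    (P[|{ω | X 0 ω = Sum.inl i}]).real (matchedEvent X) = (fundamentalMatrix M * Q) i 1 := by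
  have hpos : P.real {ω | X 0 ω = Sum.inl i} ≠ 0 := by simpa [measureReal_eq_zero_iff] using hi
  rw [Measure.real, cond_apply (hX.measurable 0 _), ENNReal.toReal_mul, ENNReal.toReal_inv]
  change (P.real _)⁻¹ * P.real _ = _
  rw [hX.measureReal_inter_matchedEvent h, inv_mul_cancel_left₀ hpos]

theorem integrable_and_integral_matchTime (h : IsAbsorbingRates M Q)
    (hX : IsCTMC (absorbingGenerator M Q) P X) {i : Fin m}
    (hi : P {ω | X 0 ω = Sum.inl i} ≠ 0) (hN : 0 < (fundamentalMatrix M * Q) i 1) :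
    Integrable (matchTime X) (P[|{ω | X 0 ω = Sum.inl i} ∩ matchedEvent X]) ∧
      ∫ ω, matchTime X ω ∂(P[|{ω | X 0 ω = Sum.inl i} ∩ matchedEvent X]) =
        (fundamentalMatrix M * (fundamentalMatrix M * Q)) i 1 / (fundamentalMatrix M * Q) i 1 := by
  set B := {ω | X 0 ω = Sum.inl i} ∩ matchedEvent X with hB
  set ν := P[|B] with hν
  set a := P.real {ω | X 0 ω = Sum.inl i} with ha
  have hBm : MeasurableSet B := (hX.measurable 0 _).inter hX.measurableSet_matchedEvent
  have hapos : 0 < a :=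
    lt_of_le_of_ne measureReal_nonneg
      (Ne.symm (by simpa [ha, measureReal_eq_zero_iff] using hi))
  set g : ℝ → ℝ := fun t => (exp (t • M) * (fundamentalMatrix M * Q)) i 1 with hg
  set f : ℝ → ℝ := fun t => g t / (fundamentalMatrix M * Q) i 1 with hf
  have hgnn : ∀ t ∈ Set.Ioi (0 : ℝ), 0 ≤ g t := fun t ht => by
    have h1 := hX.measureReal_lt_matchTime h i (Set.mem_Ioi.1 ht).le
    have h2 : 0 ≤ a * g t := h1 ▸ measureReal_nonneg
    exact nonneg_of_mul_nonneg_right h2 hapos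
  have hlim : Tendsto (fun s : ℝ => -(exp (s • M) *
      (fundamentalMatrix M * (fundamentalMatrix M * Q))) i 1) atTop (𝓝 0) := by
    simpa using (h.tendsto_exp_smul_mul (fundamentalMatrix M * (fundamentalMatrix M * Q)) i 1).neg
  have hgint : IntegrableOn g (Set.Ioi 0) :=
    integrableOn_Ioi_deriv_of_nonneg' (fun t _ => h.hasDerivAt_exp_smul_mul t i 1) hgnn hlim
  have hgval : ∫ t in Set.Ioi 0, g t =
      (fundamentalMatrix M * (fundamentalMatrix M * Q)) i 1 := by
    rw [integral_Ioi_of_hasDerivAt_of_nonneg' (fun t _ => h.hasDerivAt_exp_smul_mul t i 1)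
      hgnn hlim]
    simp [NormedSpace.exp_zero]
  have htail : ∀ t ∈ Set.Ioi (0 : ℝ), ν {ω | t < matchTime X ω} = ENNReal.ofReal (f t) := by
    intro t ht
    have : IsFiniteMeasure ν := by rw [hν]; infer_instance
    rw [← ofReal_measureReal]
    congr 1
    rw [Measure.real, hν, cond_apply hBm, ENNReal.toReal_mul, ENNReal.toReal_inv]
    change (P.real B)⁻¹ * P.real _ = _
    rw [hX.measureReal_inter_matchedEvent h, hX.measureReal_lt_matchTime h i (Set.mem_Ioi.1 ht).le]
    change (a * _)⁻¹ * (a * g t) = g t / _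
    field_simp
  have hnn : ∀ ω, 0 ≤ matchTime X ω := fun ω => NNReal.coe_nonneg _
  have hlint : ∫⁻ ω, ENNReal.ofReal (matchTime X ω) ∂ν =
      ENNReal.ofReal ((fundamentalMatrix M * (fundamentalMatrix M * Q)) i 1 /
        (fundamentalMatrix M * Q) i 1) := by
    rw [lintegral_eq_lintegral_meas_lt ν (Eventually.of_forall hnn)
      hX.measurable_matchTime.aemeasurable, setLIntegral_congr_fun measurableSet_Ioi htail,
      ← ofReal_integral_eq_lintegral_ofReal (hgint.div_const _), integral_div, hgval]
    filter_upwards [ae_restrict_mem measurableSet_Ioi] with t ht using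
      div_nonneg (hgnn t ht) hN.le
  have hval : 0 ≤ (fundamentalMatrix M * (fundamentalMatrix M * Q)) i 1 /
      (fundamentalMatrix M * Q) i 1 :=
    div_nonneg (hgval ▸ setIntegral_nonneg measurableSet_Ioi hgnn) hN.le
  refine ⟨⟨hX.measurable_matchTime.aestronglyMeasurable, ?_⟩, ?_⟩
  · rw [hasFiniteIntegral_iff_ofReal (Eventually.of_forall hnn), hlint]
    exact ENNReal.ofReal_lt_top
  · rw [integral_eq_lintegral_of_nonneg_ae (Eventually.of_forall hnn)
      hX.measurable_matchTime.aestronglyMeasurable, hlint, ENNReal.toReal_ofReal hval]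

end Absorbing

end IsCTMC

theorem proposition3 :
    -- the rider chains under First Accept and Best Accept are absorbing Markov chains
    (∀ (U : ℕ) (c : RiderParams U), 1 ≤ U → c.CanLeave →
      IsAbsorbingRates c.faM c.faQ ∧ IsAbsorbingRates c.baM c.baQ) ∧
    -- match probability and conditional match time in every such chain, `N = -M⁻¹` being the fundamental matrix
    (∀ (m : ℕ) (M : Matrix (Fin m) (Fin m) ℝ) (Q : Matrix (Fin m) (Fin 2) ℝ),
      IsAbsorbingRates M Q →
      IsUnit M.det ∧
      ∀ (Ω : Type*) [MeasurableSpace Ω] (P : Measure Ω) [IsProbabilityMeasure P]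
        (X : ℝ≥0 → Ω → Fin m ⊕ Fin 2), IsCTMC (absorbingGenerator M Q) P X →
      ∀ i : Fin m, P {ω | X 0 ω = Sum.inl i} ≠ 0 →
        (P[|{ω | X 0 ω = Sum.inl i}]).real (matchedEvent X) = (fundamentalMatrix M * Q) i 1 ∧
        (0 < (P[|{ω | X 0 ω = Sum.inl i}]).real (matchedEvent X) →
          Integrable (matchTime X) (P[|{ω | X 0 ω = Sum.inl i} ∩ matchedEvent X]) ∧
          ∫ ω, matchTime X ω ∂(P[|{ω | X 0 ω = Sum.inl i} ∩ matchedEvent X]) =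
            (fundamentalMatrix M ^ 2 * Q : Matrix (Fin m) (Fin 2) ℝ) i 1 /
              (fundamentalMatrix M * Q) i 1)) := by
  refine ⟨fun U c _ hc => ⟨c.isAbsorbingRates_firstAccept hc, c.isAbsorbingRates_bestAccept hc⟩,
    fun m M Q h => ⟨h.isUnit_det, fun Ω _ P _ X hX i hi => ?_⟩⟩
  have hprob := hX.cond_measureReal_matchedEvent h hi
  refine ⟨hprob, fun hpos => ?_⟩
  rw [pow_two, Matrix.mul_assoc]
  exact hX.integrable_and_integral_matchTime h hi (hprob ▸ hpos)
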